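/- **Setting.** Let $\iota$ be a finite abelian group indexing the signal coordinates (for instance $\mathbb Z/n$, so that $\mathbb C^\iota=\mathbb C^n$) and $\kappa$ a finite index set of measurements. Let $A\in\mathbb C^{\iota\times\kappa}$ have columns $a_i$ (the sampling vectors), let $x^\natural\in\mathbb C^\iota$, $y^\natural=A^*x^\natural$, $b=|y^\natural|$ (entrywise), and assume $b_i>0$ for all $i$. Put $b_{\min}=\min_i b_i$, $z^\natural=(x^\natural,y^\natural)$, $u=y^\natural/|y^\natural|$ (entrywise). All norms are Euclidean. Assume: 1. $A^*$ has full column rank; 2. every $x$ with $|A^*x|=b$ is obtained from $x^\natural$ by a global phase, a translation and possibly a conjugate mirror flipping; 3. every $x$ with $\frac{a_i^*x}{|a_i^*x|}=\pm\frac{a_i^*x^\natural}{|a_i^*x^\natural|}$ for all $i$ (signs depending on $i$; $0/|0|:=0$) is of the form $x=c\,x^\natural$ with $c\in\mathbb R\setminus\{0\}$. **Algorithm.** Let $\varepsilon^{\rm noise}\in\mathbb R^\kappa$ and $\tilde b=b+\varepsilon^{\rm noise}$. Let $\Pi$ be the orthogonal projection of $\mathbb C^\iota\times\mathbb C^\kappa$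 onto $\{(x,y):A^*x=y\}$, and for $a\in\mathbb R^\kappa$ let $\operatorname{prox}_a(x,y)=(x,a\circ y/|y|)$. From arbitrary $z^0=(x^0,y^0)$ and $\zeta^0=(\lambda^0,\nu^0)$, graph projection splitting (GPS) without regularization iterates $$z^{k+1/2}=\Pi(z^k-\zeta^k),\quad z^{k+1}=(x^{k+1},y^{k+1})=\operatorname{prox}_{\tilde b}(z^{k+1/2}+\zeta^k),\quad \zeta^{k+1}=\zeta^k+z^{k+1/2}-z^{k+1}.$$ Put $z_{\rm DR}^k=z^k+\zeta^k$. **Projection and neighbourhoods.** Let $\mathcal C=\{\theta\in\mathbb R^\kappa: A(\theta\circ u)=0,\ b+\theta\ge0\}$ and $\mathcal F=\{(\alpha x^\natural,\alpha(b+\theta)\circ u):|\alpha|=1,\ \theta\in\mathcal C\}$. For $k\ge1$ let $z_*^k=(\alpha_kx^\natural,\alpha_k(b+\theta_k)\circ u)$, with $|\alpha_k|=1$ and $\theta_k\in\mathcal C$, be a point of $\mathcal F$ closest to $z_{\rm DR}^k$, and let $\mathcal V_k$ be the open ball of radius $b_{\min}/2$ around $\alpha_kz^\natural$. **Linearization.**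 For $|\alpha|=1$ and $\theta\in\mathcal C$ with $b+\theta>0$, let $J_{\alpha,\theta}(v)=v+\Pi(2Dv-v)-Dv$ with $$D(p,q)=\Bigl(p,\ \tfrac{b}{b+\theta}\circ\alpha u\circ i\,\mathrm{Im}(\overline{\alpha u}\circ q)\Bigr)$$ be the (real-linear) derivative of the noiseless map $z\mapsto z+\Pi(2\operatorname{prox}_b(z)-z)-\operatorname{prox}_b(z)$ at $(\alpha x^\natural,\alpha(b+\theta)\circ u)$. **Theorem (noisy case).** There is a constant $0<\beta<1$, depending only on $A$ and $x^\natural$, with the following property. Let $\varepsilon_1>0$ with $\beta+\varepsilon_1<1$, and let $0<\varepsilon_2<b_{\min}/3$ be such that $\|J_{\alpha,\theta}-J_{\alpha,0}\|\le\varepsilon_1$ (operator norm) for all $|\alpha|=1$ and all $\theta\in\mathcal C$ with $\|\theta\|\le\varepsilon_2$. Then there is $\varepsilon_3>0$ such that for every noise vector, every starting point of GPS and every choice of the closest points $z_*^k$ with $$\|\varepsilon^{\rm noise}\|<\|z_{\rm DR}^1-z_*^1\|\le\varepsilon_3,$$ the following holds for each $k\ge1$: if $z_{\rm DR}^j\in\mathcal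 V_j$ and $\|z_*^j-z^\natural\|\le\varepsilon_2$ for all $1\le j<k$, then $$\min_{|\alpha|=1}\|x^k-\alpha x^\natural\|\ \le\ (\beta+\varepsilon_1)^{k-1}\,\|z_{\rm DR}^1-z_*^1\|+\frac{1}{1-(\beta+\varepsilon_1)}\,\|\varepsilon^{\rm noise}\|.$$ -/

import Mathlib

open scoped Matrix ComplexConjugate

noncomputable section

namespace GPS

variable {ι κ : Type*} [Fintype ι] [Fintype κ]

/-- The stacked space of pairs `(x, y)` of a signal `x ∈ ℂ^ι` and a measurement vector `y ∈ ℂ^κ`,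
with the Euclidean norm `‖(x, y)‖² = ‖x‖² + ‖y‖²`. -/
abbrev Stack (ι κ : Type*) [Fintype ι] [Fintype κ] : Type _ :=
  WithLp 2 (EuclideanSpace ℂ ι × EuclideanSpace ℂ κ)

/-- The stacked vector `(x, y)`. -/
def stack (x : EuclideanSpace ℂ ι) (y : EuclideanSpace ℂ κ) : Stack ι κ := WithLp.toLp 2 (x, y)

/-- The phase `z / |z|`, with the convention `0 / |0| = 0`. -/
def phase (z : ℂ) : ℂ := z / (‖z‖ : ℂ)

/-- The linear measurements `A* x = (a_i* x)_i`; the sampling vectors `a_i` are the columns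
of `A`. -/
def meas (A : Matrix ι κ ℂ) (x : EuclideanSpace ℂ ι) : EuclideanSpace ℂ κ :=
  WithLp.toLp 2 (Aᴴ *ᵥ x.ofLp)

/-- `x` arises from `x₀` by a global phase, a translation and possibly a (conjugate) mirror
flipping. The index set of the signals is a finite abelian group, for instance `ℤ/n`
or `ℤ/n₁ × ℤ/n₂`. -/
def TrivialAmbiguity [AddCommGroup ι] (x₀ x : EuclideanSpace ℂ ι) : Prop :=
  ∃ c : ℂ, ‖c‖ = 1 ∧ ∃ s : ι,
    (∀ j, x j = c * x₀ (j + s)) ∨ (∀ j, x j = c * conj (x₀ (s - j)))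

/-- The assumptions on the sampling vectors, the noiseless amplitudes `b` and the true
signal `x₀`. -/
structure Assumptions [AddCommGroup ι] (A : Matrix ι κ ℂ) (b : EuclideanSpace ℝ κ)
    (x₀ : EuclideanSpace ℂ ι) : Prop where
  /-- the noiseless amplitudes are positive -/
  b_pos : ∀ i, 0 < b i
  /-- `x₀` solves the noiseless phase retrieval problem -/
  sol : ∀ i, ‖meas A x₀ i‖ = b i
  /-- `A*` has full column rank -/
  full_rank : Aᴴ.rank = Fintype.card ι
  /-- uniqueness of phase retrieval up to trivial ambiguities -/
  phase_retrieval : ∀ x : EuclideanSpace ℂ ι, (∀ i, ‖meas A x i‖ = b i) → TrivialAmbiguity x₀ x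
  /-- uniqueness of magnitude retrieval up to a real factor -/
  magnitude_retrieval : ∀ x : EuclideanSpace ℂ ι,
    (∀ i, phase (meas A x i) = phase (meas A x₀ i) ∨
      phase (meas A x i) = -phase (meas A x₀ i)) →
    ∃ c : ℝ, c ≠ 0 ∧ x = (c : ℂ) • x₀

/-- The graph set `{(x, y) | A* x = y}`. -/
def graphSet (A : Matrix ι κ ℂ) : Submodule ℂ (Stack ι κ) where
  carrier := {z | meas A z.fst = z.snd}
  zero_mem' := by simp [meas]
  add_mem' := by
    intro z w hz hw
    simp only [Set.mem_ofPred_eq] at hz hw ⊢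
    rw [WithLp.add_fst, WithLp.add_snd, ← hz, ← hw]
    simp [meas, Matrix.mulVec_add]
  smul_mem' := by
    intro c z hz
    simp only [Set.mem_ofPred_eq] at hz ⊢
    rw [WithLp.smul_fst, WithLp.smul_snd, ← hz]
    simp [meas, Matrix.mulVec_smul]

/-- The graph projection: orthogonal projection onto the graph set. -/
def graphProj (A : Matrix ι κ ℂ) (z : Stack ι κ) : Stack ι κ := (graphSet A).starProjection z

/-- The proximity operator of `(x, y) ↦ g x + f y` for `g = 0` and `f` the indicator function of
`{y | |y| = a}`, i.e. `(x, y) ↦ (x, a ∘ y / |y|)`. -/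
def prox (a : EuclideanSpace ℝ κ) (z : Stack ι κ) : Stack ι κ :=
  stack z.fst (WithLp.toLp 2 fun i => (a i : ℂ) * phase (z.snd i))

/-- A state of the algorithm: the primal variables `z = (x, y)` and the dual variables
`ζ = (lam, ν)`. -/
structure State (ι κ : Type*) [Fintype ι] [Fintype κ] where
  z : Stack ι κ
  ζ : Stack ι κ

/-- One step of graph projection splitting with amplitude data `a`. -/
def step (A : Matrix ι κ ℂ) (a : EuclideanSpace ℝ κ) (s : State ι κ) : State ι κ :=
  let zHalf := graphProj A (s.z - s.ζ)
  let zNew := prox a (zHalf + s.ζ)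
  ⟨zNew, s.ζ + zHalf - zNew⟩

/-- The `k`-th iterate of graph projection splitting started at `s₀`. -/
def iter (A : Matrix ι κ ℂ) (a : EuclideanSpace ℝ κ) (s₀ : State ι κ) (k : ℕ) : State ι κ :=
  (step A a)^[k] s₀

/-- The Douglas–Rachford variable `z + ζ` of a state. -/
def State.dr (s : State ι κ) : Stack ι κ := s.z + s.ζ

/-- The distance up to a global phase, `min_{|α| = 1} ‖x - α x₀‖`. -/
def phaseDist (x x₀ : EuclideanSpace ℂ ι) : ℝ := ⨅ α : Circle, ‖x - (α : ℂ) • x₀‖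

/-- The stacked solution `(x₀, A* x₀)`. -/
def solPoint (A : Matrix ι κ ℂ) (x₀ : EuclideanSpace ℂ ι) : Stack ι κ := stack x₀ (meas A x₀)

/-- The set of `θ ∈ ℝ^κ` with `A (θ ∘ y₀ / |y₀|) = 0` and `b + θ ≥ 0`, where `y₀ = A* x₀`. -/
def shiftSet (A : Matrix ι κ ℂ) (b : EuclideanSpace ℝ κ) (x₀ : EuclideanSpace ℂ ι) :
    Set (EuclideanSpace ℝ κ) :=
  {θ | A *ᵥ (fun i => (θ i : ℂ) * phase (meas A x₀ i)) = 0 ∧ ∀ i, 0 ≤ b i + θ i}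

/-- The point `(α x₀, α (b + θ) ∘ y₀ / |y₀|)`, where `y₀ = A* x₀`. -/
def fixedPoint (A : Matrix ι κ ℂ) (b : EuclideanSpace ℝ κ) (x₀ : EuclideanSpace ℂ ι)
    (α : ℂ) (θ : EuclideanSpace ℝ κ) : Stack ι κ :=
  stack (α • x₀)
    (WithLp.toLp 2 fun i => α * (((b i + θ i : ℝ) : ℂ) * phase (meas A x₀ i)))

/-- The set of all these points with `|α| = 1` and `θ` in `shiftSet`. -/
def fixedSet (A : Matrix ι κ ℂ) (b : EuclideanSpace ℝ κ) (x₀ : EuclideanSpace ℂ ι) :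
    Set (Stack ι κ) :=
  {w | ∃ α : ℂ, ‖α‖ = 1 ∧ ∃ θ ∈ shiftSet A b x₀, w = fixedPoint A b x₀ α θ}

/-- The point of `fixedSet` with parameters `α, θ` is a projection of `z` onto `fixedSet`,
i.e. a point of `fixedSet` closest to `z`. -/
def IsProjection (A : Matrix ι κ ℂ) (b : EuclideanSpace ℝ κ) (x₀ : EuclideanSpace ℂ ι)
    (z : Stack ι κ) (α : ℂ) (θ : EuclideanSpace ℝ κ) : Prop :=
  ‖α‖ = 1 ∧ θ ∈ shiftSet A b x₀ ∧
    ∀ w ∈ fixedSet A b x₀, ‖fixedPoint A b x₀ α θ - z‖ ≤ ‖w - z‖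

/-- The smallest amplitude. -/
def bMin (b : EuclideanSpace ℝ κ) : ℝ := ⨅ i, b i

/-- The open ball of radius `bMin b / 2` around `α (x₀, A* x₀)`. -/
def nbhd (A : Matrix ι κ ℂ) (b : EuclideanSpace ℝ κ) (x₀ : EuclideanSpace ℂ ι) (α : ℂ) :
    Set (Stack ι κ) :=
  Metric.ball (α • solPoint A x₀) (bMin b / 2)

/-- The real-linear derivative of `prox b` at `fixedPoint A b x₀ α θ`: with `u = α y₀ / |y₀|`,
it maps `(p, q)` to `(p, b / (b + θ) ∘ u ∘ i Im (conj u ∘ q))`. -/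
def proxDeriv (A : Matrix ι κ ℂ) (b : EuclideanSpace ℝ κ) (x₀ : EuclideanSpace ℂ ι)
    (α : ℂ) (θ : EuclideanSpace ℝ κ) (v : Stack ι κ) : Stack ι κ :=
  stack v.fst (WithLp.toLp 2 fun i =>
    ((b i / (b i + θ i) : ℝ) : ℂ) * ((α * phase (meas A x₀ i)) *
      (Complex.I * (((conj (α * phase (meas A x₀ i)) * v.snd i).im : ℝ) : ℂ))))

/-- The linearization `v ↦ v + Π (2 D v - v) - D v` of the noiseless Douglas–Rachford map at
`fixedPoint A b x₀ α θ`, where `D` is the derivative of `prox b` there. -/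
def drDeriv (A : Matrix ι κ ℂ) (b : EuclideanSpace ℝ κ) (x₀ : EuclideanSpace ℂ ι)
    (α : ℂ) (θ : EuclideanSpace ℝ κ) (v : Stack ι κ) : Stack ι κ :=
  v + graphProj A ((2 : ℂ) • proxDeriv A b x₀ α θ v - v) - proxDeriv A b x₀ α θ v

/-- `ε₂` controls the variation of the linearization by `ε₁`: for all admissible `θ` of norm at
most `ε₂`, the operator norm of the difference of the linearizations at `θ` and at `0` is at most
`ε₁`. -/
def LinearizationClose (A : Matrix ι κ ℂ) (b : EuclideanSpace ℝ κ) (x₀ : EuclideanSpace ℂ ι)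
    (ε₁ ε₂ : ℝ) : Prop :=
  ∀ α : ℂ, ‖α‖ = 1 → ∀ θ ∈ shiftSet A b x₀, ‖θ‖ ≤ ε₂ → ∀ v : Stack ι κ,
    ‖drDeriv A b x₀ α θ v - drDeriv A b x₀ α 0 v‖ ≤ ε₁ * ‖v‖

end GPS

end

/-!
The variable `z + ζ` evolves by the Douglas–Rachford map, which commutes with global phases, so a
step can be studied near a fixed point with `α = 1`. There the noiseless map agrees with its
linearization up to a quadratic error, and noise moves its value by at most `‖noise‖`, because the
map depends on `prox` only through a reflection.

The linearization at `θ = 0` sends `v` to `(v + R (2 D v - v)) / 2`, where `R` is the reflection in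
the graph set and `v ↦ 2 D v - v` is isometric. If it does not shrink `v`, then by strict convexity
`Π v = D v`, and magnitude retrieval makes `v` the sum of a shift and an imaginary multiple of the
solution, that is, a tangent vector of the set of fixed points. The vector from the closest fixed
point to the iterate is normal to this set, so on such vectors the linearization contracts strictly,
and by compactness uniformly. Since `β` is taken larger than the contraction factor, the gap between
them absorbs the quadratic error as long as the iterates stay close to the fixed points, which the
recursion itself guarantees.
-/

namespace GPS

/-! ### The phase function -/

lemma norm_phase_le (z : ℂ) : ‖phase z‖ ≤ 1 := by
  rw [phase, norm_div, Complex.norm_real, norm_norm]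
  exact div_self_le_one _

lemma norm_phase {z : ℂ} (hz : z ≠ 0) : ‖phase z‖ = 1 := by
  rw [phase, norm_div, Complex.norm_real, norm_norm]
  exact div_self (norm_ne_zero_iff.2 hz)

lemma norm_mul_phase (z : ℂ) : (‖z‖ : ℂ) * phase z = z :=
  mul_div_cancel_of_imp' fun h ↦ by simpa using h

lemma phase_mul (z w : ℂ) : phase (z * w) = phase z * phase w := by
  simp only [phase, norm_mul, Complex.ofReal_mul, mul_div_mul_comm]

lemma phase_of_norm_eq_one {u : ℂ} (hu : ‖u‖ = 1) : phase u = u := by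
  simp [phase, hu]

lemma phase_ofReal_mul {r : ℝ} (hr : 0 < r) (z : ℂ) : phase (r * z) = phase z := by
  have hr₁ : phase r = 1 := by
    rw [phase, Complex.norm_real, Real.norm_of_nonneg hr.le]
    exact div_self (Complex.ofReal_ne_zero.2 hr.ne')
  rw [phase_mul, hr₁, one_mul]

lemma norm_phase_one_add_sub_le (h : ℂ) :
    ‖phase (1 + h) - 1 - Complex.I * h.im‖ ≤ 4 * ‖h‖ ^ 2 := by
  rcases eq_or_ne (1 + h) 0 with h₀ | h₀
  · obtain rfl : h = -1 := by linear_combination h₀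
    norm_num [phase]
  set e := phase (1 + h)
  set m := ‖1 + h‖
  have norm_e : ‖e‖ = 1 := norm_phase h₀
  have hme : (m : ℂ) * e = 1 + h := norm_mul_phase _
  have hm₁ : |1 - m| ≤ ‖h‖ := by
    simpa [abs_sub_comm] using abs_norm_sub_norm_le (1 + h) 1
  have hdist : ‖e - 1‖ ≤ 2 * ‖h‖ := calc
    ‖e - 1‖ = ‖((1 - m : ℝ) : ℂ) * e + h‖ := by
      congr 1; push_cast; linear_combination hme
    _ ≤ |1 - m| + ‖h‖ := by
      refine (norm_add_le _ _).trans_eq ?_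
      rw [norm_mul, norm_e, mul_one, Complex.norm_real, Real.norm_eq_abs]
    _ ≤ 2 * ‖h‖ := by linarith
  have hre : |e.re - 1| ≤ 2 * ‖h‖ ^ 2 := by
    have h₁ : ‖e - 1‖ ^ 2 = 2 * (1 - e.re) := by
      have h₂ : e.re * e.re + e.im * e.im = 1 := by
        rw [← Complex.normSq_apply, Complex.normSq_eq_norm_sq, norm_e, one_pow]
      rw [← Complex.normSq_eq_norm_sq, Complex.normSq_apply]
      simp only [Complex.sub_re, Complex.sub_im, Complex.one_re, Complex.one_im]
      linarith
    rw [abs_sub_comm, abs_of_nonneg (by linarith [sq_nonneg ‖e - 1‖])]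
    nlinarith [norm_nonneg (e - 1)]
  have him : |e.im - h.im| ≤ 2 * ‖h‖ ^ 2 := by
    have h₁ : m * e.im = h.im := by simpa using congrArg Complex.im hme
    have h₂ : |e.im| ≤ ‖e - 1‖ := by simpa using Complex.abs_im_le_norm (e - 1)
    calc |e.im - h.im| = |e.im| * |1 - m| := by rw [← h₁, ← abs_mul]; ring_nf
      _ ≤ (2 * ‖h‖) * ‖h‖ := by gcongr; exact h₂.trans hdist
      _ = 2 * ‖h‖ ^ 2 := by ring
  calc ‖e - 1 - Complex.I * h.im‖ ≤ |e.re - 1| + |e.im - h.im| := by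
        simpa using Complex.norm_le_abs_re_add_abs_im (e - 1 - Complex.I * h.im)
    _ ≤ 4 * ‖h‖ ^ 2 := by linarith

lemma mul_conj_of_norm_eq_one {u : ℂ} (hu : ‖u‖ = 1) : u * conj u = 1 := by
  rw [Complex.mul_conj, Complex.normSq_eq_norm_sq, hu, one_pow, Complex.ofReal_one]

lemma norm_phase_add_sub_le {r : ℝ} (hr : 0 < r) {u : ℂ} (hu : ‖u‖ = 1) (q : ℂ) :
    ‖phase (r * u + q) - u - (r⁻¹ : ℝ) * (u * (Complex.I * (conj u * q).im))‖
      ≤ 4 * (‖q‖ / r) ^ 2 := by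
  set h : ℂ := (r⁻¹ : ℝ) * (conj u * q) with hh
  have norm_h : ‖h‖ = ‖q‖ / r := by
    rw [hh, norm_mul, norm_mul, RCLike.norm_conj, hu, Complex.norm_real,
      Real.norm_of_nonneg (by positivity)]
    ring
  have him : (h.im : ℂ) = (r⁻¹ : ℝ) * (conj u * q).im := by
    rw [hh, Complex.im_ofReal_mul, Complex.ofReal_mul]
  have hphase : phase (r * u + q) = u * phase (1 + h) := by
    have hr₀ : (r : ℂ) * (r⁻¹ : ℝ) = 1 := by
      rw [← Complex.ofReal_mul, mul_inv_cancel₀ hr.ne', Complex.ofReal_one]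
    have hfactor : r * u + q = r * (u * (1 + h)) := by
      linear_combination -q * mul_conj_of_norm_eq_one hu - u * conj u * q * hr₀
    rw [hfactor, phase_ofReal_mul hr, phase_mul, phase_of_norm_eq_one hu]
  calc _ = ‖u * (phase (1 + h) - 1 - Complex.I * h.im)‖ := by
        rw [hphase, him]; congr 1; ring
    _ ≤ 4 * (‖q‖ / r) ^ 2 := by
        rw [norm_mul, hu, one_mul, ← norm_h]
        exact norm_phase_one_add_sub_le h

lemma eq_mul_I_im_add_mul_re {u : ℂ} (hu : ‖u‖ = 1) (q : ℂ) :
    q = u * (Complex.I * (conj u * q).im) + u * (conj u * q).re := by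
  linear_combination -q * mul_conj_of_norm_eq_one hu - u * Complex.re_add_im (conj u * q)

/-! ### Hilbert spaces -/

section Hilbert

variable {𝕜 E : Type*} [RCLike 𝕜] [NormedAddCommGroup E] [InnerProductSpace 𝕜 E]

lemma add_starProjection_two_smul_sub_sub (K : Submodule 𝕜 E) [K.HasOrthogonalProjection]
    (w p : E) : w + K.starProjection ((2 : 𝕜) • p - w) - p
      = (w - K.starProjection w) + K.reflection p := by
  rw [map_sub, map_smul, K.reflection_apply, ofNat_smul_eq_nsmul 𝕜 2]
  abel

/-- The left-hand side of `hle` is half of `v + R (2 p - v)`, where `R` is the reflection in `K`.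
As `v` and `R (2 p - v)` have the same norm, they coincide by strict convexity. -/
lemma starProjection_eq_of_norm_le (K : Submodule 𝕜 E) [K.HasOrthogonalProjection] {v p : E}
    (hp : ‖(2 : 𝕜) • p - v‖ = ‖v‖)
    (hle : ‖v‖ ≤ ‖v + K.starProjection ((2 : 𝕜) • p - v) - p‖) : K.starProjection v = p := by
  let := NormedSpace.restrictScalars ℝ 𝕜 E
  let : InnerProductSpace ℝ E := InnerProductSpace.rclikeToReal 𝕜 E
  set w := K.reflection ((2 : 𝕜) • p - v) with hw
  have norm_w : ‖v‖ = ‖w‖ := by rw [hw, LinearIsometryEquiv.norm_map, hp]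
  have hadd : v + w = (2 : 𝕜) • (v + K.starProjection ((2 : 𝕜) • p - v) - p) := by
    rw [hw, K.reflection_apply, ← ofNat_smul_eq_nsmul 𝕜 2]
    module
  have norm_add : ‖v + w‖ = ‖v‖ + ‖w‖ := by
    refine le_antisymm (norm_add_le v w) ?_
    rw [← norm_w, ← two_mul, hadd, norm_smul, RCLike.norm_ofNat]
    gcongr
  have hvw : v = w := eq_of_norm_eq_of_norm_add_eq norm_w norm_add
  have hreflect : K.reflection v = (2 : 𝕜) • p - v := by
    rw [congrArg K.reflection hvw, hw, Submodule.reflection_reflection]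
  rw [K.reflection_apply, ← ofNat_smul_eq_nsmul 𝕜 2] at hreflect
  exact smul_right_injective E (two_ne_zero (α := 𝕜)) (sub_left_injective hreflect)

end Hilbert

lemma inner_eq_zero_of_isLocalMin_norm_sub {E : Type*} [NormedAddCommGroup E]
    [InnerProductSpace ℝ E] {γ : ℝ → E} {d w : E} {t : ℝ} (hγ : HasDerivAt γ d t)
    (hmin : IsLocalMin (fun s ↦ ‖γ s - w‖) t) : inner ℝ (γ t - w) d = 0 := by
  have hmin_sq : IsLocalMin (fun s ↦ ‖γ s - w‖ ^ 2) t := by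
    filter_upwards [hmin] with s hs
    gcongr
  simpa using hmin_sq.hasDerivAt_eq_zero (hγ.sub_const w).norm_sq

section ComplexHilbert

variable {E : Type*} [NormedAddCommGroup E] [InnerProductSpace ℂ E]

lemma re_inner_eq_zero_of_eventually_norm_sub_le {z d w : E}
    (h : ∀ᶠ t : ℝ in nhds 0, ‖z - w‖ ≤ ‖z + (t : ℂ) • d - w‖) :
    (inner ℂ d (w - z)).re = 0 := by
  let : InnerProductSpace ℝ E := InnerProductSpace.complexToReal
  have hγ : HasDerivAt (fun t : ℝ ↦ z + t • d) d 0 := by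
    simpa using ((hasDerivAt_id (0 : ℝ)).smul_const d).const_add z
  have hmin : IsLocalMin (fun t : ℝ ↦ ‖z + t • d - w‖) 0 := by
    filter_upwards [h] with t ht
    simpa using ht
  have := inner_eq_zero_of_isLocalMin_norm_sub hγ hmin
  rw [zero_smul, add_zero, real_inner_comm] at this
  rw [← neg_sub z w, inner_neg_right, Complex.neg_re, neg_eq_zero]
  exact this

lemma im_inner_eq_zero_of_norm_sub_le_smul {z w : E}
    (h : ∀ c : ℂ, ‖c‖ = 1 → ‖z - w‖ ≤ ‖c • z - w‖) : (inner ℂ z (w - z)).im = 0 := by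
  let : InnerProductSpace ℝ E := InnerProductSpace.complexToReal
  have hexp : HasDerivAt (fun t : ℝ ↦ Complex.exp (t * Complex.I)) Complex.I 0 := by
    simpa using (Complex.ofRealCLM.hasDerivAt (x := 0)).mul_const Complex.I |>.cexp
  have hmin : IsLocalMin (fun t : ℝ ↦ ‖Complex.exp (t * Complex.I) • z - w‖) 0 := by
    refine .of_forall fun t ↦ ?_
    simpa using h _ (Complex.norm_exp_ofReal_mul_I t)
  have hre : (inner ℂ (z - w) (Complex.I • z)).re = 0 := by
    have := inner_eq_zero_of_isLocalMin_norm_sub (hexp.smul_const z) hmin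
    rwa [Complex.ofReal_zero, zero_mul, Complex.exp_zero, one_smul] at this
  rw [inner_smul_right, Complex.I_mul_re, neg_eq_zero] at hre
  rw [← neg_sub z w, ← inner_conj_symm, inner_neg_left, map_neg, Complex.neg_im, Complex.conj_im,
    neg_neg, hre]

end ComplexHilbert

lemma exists_norm_le_mul_norm_of_isCompact {P E F : Type*} [TopologicalSpace P]
    [NormedAddCommGroup E] [NormedSpace ℝ E] [ProperSpace E] [NormedAddCommGroup F]
    [NormedSpace ℝ F] {K : Set P} (hK : IsCompact K) {N : P → E → Prop}
    (hN : IsClosed {x : P × E | N x.1 x.2})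
    (hNsmul : ∀ {p v} (t : ℝ), N p v → N p (t • v)) {f : E → F} (hf : Continuous f)
    (hfsmul : ∀ (t : ℝ) v, f (t • v) = t • f v)
    (hlt : ∀ p ∈ K, ∀ v, N p v → ‖v‖ ≤ ‖f v‖ → v = 0) :
    ∃ β : ℝ, 0 ≤ β ∧ β < 1 ∧ ∀ p ∈ K, ∀ v, N p v → ‖f v‖ ≤ β * ‖v‖ := by
  set S : Set (P × E) := (K ×ˢ Metric.sphere 0 1) ∩ {x | N x.1 x.2}
  have hScompact : IsCompact S := (hK.prod (isCompact_sphere _ _)).inter_right hN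
  obtain ⟨β, hβ₀, hβ₁, hβ⟩ : ∃ β : ℝ, 0 ≤ β ∧ β < 1 ∧ ∀ x ∈ S, ‖f x.2‖ ≤ β := by
    rcases S.eq_empty_or_nonempty with hempty | hne
    · exact ⟨0, le_rfl, one_pos, by simp [hempty]⟩
    · have hcont : Continuous fun x : P × E ↦ ‖f x.2‖ := (hf.comp continuous_snd).norm
      obtain ⟨⟨p, v⟩, ⟨⟨hp, hv⟩, hpv⟩, hmax⟩ :=
        hScompact.exists_isMaxOn hne hcont.continuousOn
      refine ⟨‖f v‖, norm_nonneg _, ?_, fun x hx ↦ hmax hx⟩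
      have norm_v : ‖v‖ = 1 := mem_sphere_zero_iff_norm.1 hv
      by_contra! hge
      simp [hlt p hp v hpv (norm_v.le.trans hge)] at norm_v
  refine ⟨β, hβ₀, hβ₁, fun p hp v hpv ↦ ?_⟩
  rcases eq_or_ne v 0 with rfl | hv
  · have hf₀ : f 0 = 0 := by simpa using hfsmul 0 0
    simp [hf₀]
  have hmem : (p, ‖v‖⁻¹ • v) ∈ S :=
    ⟨⟨hp, mem_sphere_zero_iff_norm.2 (norm_smul_inv_norm (𝕜 := ℝ) hv)⟩, hNsmul _ hpv⟩
  have hle := hβ _ hmem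
  rwa [hfsmul, norm_smul, norm_inv, norm_norm, inv_mul_le_iff₀ (norm_pos_iff.2 hv),
    mul_comm] at hle

lemma le_pow_mul_add_of_le_add_mul_self_mul_add {d : ℕ → ℝ} {q ρ C e : ℝ} {N : ℕ}
    (hd : ∀ n, 0 ≤ d n) (hC : 0 ≤ C) (hρ₀ : 0 ≤ ρ) (hρ₁ : ρ < 1) (he₀ : 0 ≤ e) (he : e ≤ d 0)
    (hsmall : C * ((1 + 1 / (1 - ρ)) * d 0) ≤ ρ - q)
    (hstep : ∀ n < N, d (n + 1) ≤ (q + C * d n) * d n + e) :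
    ∀ n ≤ N, d n ≤ ρ ^ n * d 0 + 1 / (1 - ρ) * e := by
  have hgap : 0 < 1 - ρ := sub_pos.2 hρ₁
  intro n
  induction n with
  | zero =>
    intro _
    rw [pow_zero, one_mul]
    exact le_add_of_nonneg_right (by positivity)
  | succ n ih =>
    intro hn
    have ih := ih (by omega)
    have hbound : d n ≤ (1 + 1 / (1 - ρ)) * d 0 := calc
      d n ≤ ρ ^ n * d 0 + 1 / (1 - ρ) * e := ih
      _ ≤ 1 * d 0 + 1 / (1 - ρ) * d 0 := by
        have := hd 0
        gcongr
        exact pow_le_one₀ hρ₀ hρ₁.le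
      _ = (1 + 1 / (1 - ρ)) * d 0 := by ring
    have hfactor : q + C * d n ≤ ρ := by
      have : C * d n ≤ C * ((1 + 1 / (1 - ρ)) * d 0) := by gcongr
      linarith
    calc d (n + 1) ≤ (q + C * d n) * d n + e := hstep n (by omega)
      _ ≤ ρ * (ρ ^ n * d 0 + 1 / (1 - ρ) * e) + e := by
        have := hd n
        gcongr
      _ = ρ ^ (n + 1) * d 0 + 1 / (1 - ρ) * e := by
        have := hgap.ne'
        field_simp
        ring

/-! ### Stacked vectors and the graph set -/

section Stack

variable {ι κ : Type*} [Fintype ι] [Fintype κ]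

@[simp] lemma fst_stack (x : EuclideanSpace ℂ ι) (y : EuclideanSpace ℂ κ) :
    (stack x y).fst = x := rfl

@[simp] lemma snd_stack (x : EuclideanSpace ℂ ι) (y : EuclideanSpace ℂ κ) :
    (stack x y).snd = y := rfl

lemma stack_ext {v w : Stack ι κ} (h₁ : v.fst = w.fst) (h₂ : ∀ i, v.snd i = w.snd i) : v = w :=
  WithLp.ofLp_injective 2 (Prod.ext h₁ (PiLp.ext h₂))

lemma norm_le_norm_of_norm_apply_le {v w : Stack ι κ} (h₁ : ‖v.fst‖ ≤ ‖w.fst‖)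
    (h₂ : ∀ i, ‖v.snd i‖ ≤ ‖w.snd i‖) : ‖v‖ ≤ ‖w‖ := by
  rw [WithLp.prod_norm_eq_of_L2, WithLp.prod_norm_eq_of_L2, EuclideanSpace.norm_eq v.snd,
    EuclideanSpace.norm_eq w.snd]
  gcongr
  exact h₂ _

/-- The stacked vector `(0, θ ∘ u)` as a real-linear function of `θ`. With `u = y₀ / |y₀|` these
are the directions in which the amplitudes of the solution are shifted. -/
def shiftVec (u : κ → ℂ) : EuclideanSpace ℝ κ →ₗ[ℝ] Stack ι κ where
  toFun θ := stack 0 (WithLp.toLp 2 fun i ↦ (θ i : ℂ) * u i)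
  map_add' θ η := stack_ext (by simp) fun i ↦ by simp [add_mul]
  map_smul' t θ := stack_ext (by simp) fun i ↦ by simp [mul_assoc]

@[simp] lemma fst_shiftVec (u : κ → ℂ) (θ : EuclideanSpace ℝ κ) :
    (shiftVec u θ : Stack ι κ).fst = 0 := rfl

@[simp] lemma snd_shiftVec (u : κ → ℂ) (θ : EuclideanSpace ℝ κ) (i : κ) :
    (shiftVec u θ : Stack ι κ).snd i = θ i * u i := rfl

lemma norm_sq_shiftVec (u : κ → ℂ) (θ : EuclideanSpace ℝ κ) :
    ‖(shiftVec u θ : Stack ι κ)‖ ^ 2 = ∑ i, (‖θ i‖ * ‖u i‖) ^ 2 := by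
  simp [WithLp.prod_norm_sq_eq_of_L2, EuclideanSpace.norm_sq_eq]

lemma norm_shiftVec_le {u : κ → ℂ} (hu : ∀ i, ‖u i‖ ≤ 1) (θ : EuclideanSpace ℝ κ) :
    ‖(shiftVec u θ : Stack ι κ)‖ ≤ ‖θ‖ := by
  rw [← sq_le_sq₀ (norm_nonneg _) (norm_nonneg _), norm_sq_shiftVec, EuclideanSpace.norm_sq_eq]
  gcongr with i
  exact mul_le_of_le_one_right (norm_nonneg _) (hu i)

lemma norm_shiftVec {u : κ → ℂ} (hu : ∀ i, ‖u i‖ = 1) (θ : EuclideanSpace ℝ κ) :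
    ‖(shiftVec u θ : Stack ι κ)‖ = ‖θ‖ := by
  rw [← sq_eq_sq₀ (norm_nonneg _) (norm_nonneg _), norm_sq_shiftVec, EuclideanSpace.norm_sq_eq]
  simp only [hu, mul_one]

lemma mem_graphSet {A : Matrix ι κ ℂ} {z : Stack ι κ} :
    z ∈ graphSet A ↔ meas A z.fst = z.snd := Iff.rfl

lemma solPoint_mem_graphSet (A : Matrix ι κ ℂ) (x : EuclideanSpace ℂ ι) :
    solPoint A x ∈ graphSet A := mem_graphSet.2 rfl

lemma eq_of_mem_graphSet {A : Matrix ι κ ℂ} {z w : Stack ι κ} (hz : z ∈ graphSet A)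
    (hw : w ∈ graphSet A) (h : z.fst = w.fst) : z = w :=
  stack_ext h fun i ↦ by rw [← mem_graphSet.1 hz, ← mem_graphSet.1 hw, h]

lemma inner_solPoint_stack_zero (A : Matrix ι κ ℂ) (x : EuclideanSpace ℂ ι)
    (y : EuclideanSpace ℂ κ) :
    inner ℂ (solPoint A x) (stack 0 y) = inner ℂ x (WithLp.toLp 2 (A *ᵥ y.ofLp)) := by
  rw [WithLp.prod_inner_apply]
  simp only [solPoint, stack, meas, inner_zero_right, zero_add,
    EuclideanSpace.inner_eq_star_dotProduct]
  rw [Matrix.star_mulVec, Matrix.conjTranspose_conjTranspose, dotProduct_comm,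
    ← Matrix.dotProduct_mulVec, dotProduct_comm]

lemma stack_zero_mem_graphSet_orthogonal {A : Matrix ι κ ℂ} {y : EuclideanSpace ℂ κ} :
    stack (0 : EuclideanSpace ℂ ι) y ∈ (graphSet A)ᗮ ↔ A *ᵥ y.ofLp = 0 := by
  rw [Submodule.mem_orthogonal]
  constructor
  · intro h
    have := h _ (solPoint_mem_graphSet A (WithLp.toLp 2 (A *ᵥ y.ofLp)))
    rw [inner_solPoint_stack_zero, inner_self_eq_zero] at this
    simpa using this
  · intro h z hz
    rw [eq_of_mem_graphSet hz (solPoint_mem_graphSet A z.fst) rfl, inner_solPoint_stack_zero, h,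
      WithLp.toLp_zero, inner_zero_right]

end Stack

/-! ### The Douglas–Rachford map -/

section DouglasRachford

variable {ι κ : Type*} [Fintype ι] [Fintype κ]

/-- The Douglas–Rachford map `w ↦ w + Π (2 prox_a w - w) - prox_a w` with amplitude data `a`,
which drives the variable `z + ζ` of graph projection splitting. -/
noncomputable def drMap (A : Matrix ι κ ℂ) (a : EuclideanSpace ℝ κ) (w : Stack ι κ) : Stack ι κ :=
  w + graphProj A ((2 : ℂ) • prox a w - w) - prox a w

lemma iter_succ_z (A : Matrix ι κ ℂ) (a : EuclideanSpace ℝ κ) (s : State ι κ) (k : ℕ) :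
    (iter A a s (k + 1)).z = prox a (iter A a s (k + 1)).dr := by
  simp only [iter, Function.iterate_succ_apply', step, State.dr]
  congr 1
  abel

lemma iter_succ_succ_dr (A : Matrix ι κ ℂ) (a : EuclideanSpace ℝ κ) (s : State ι κ) (k : ℕ) :
    (iter A a s (k + 2)).dr = drMap A a (iter A a s (k + 1)).dr := by
  have hz := iter_succ_z A a s k
  have hiter : iter A a s (k + 2) = step A a (iter A a s (k + 1)) :=
    Function.iterate_succ_apply' _ _ _
  set t := iter A a s (k + 1)
  have hreflect : (2 : ℂ) • prox a t.dr - t.dr = t.z - t.ζ := by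
    rw [← hz, State.dr, two_smul]
    abel
  rw [hiter, drMap, hreflect, ← hz]
  simp only [step, State.dr]
  abel

lemma drMap_eq (A : Matrix ι κ ℂ) (a : EuclideanSpace ℝ κ) (w : Stack ι κ) :
    drMap A a w = (w - graphProj A w) + (graphSet A).reflection (prox a w) :=
  add_starProjection_two_smul_sub_sub _ _ _

lemma drDeriv_eq (A : Matrix ι κ ℂ) (b : EuclideanSpace ℝ κ) (x₀ : EuclideanSpace ℂ ι) (α : ℂ)
    (θ : EuclideanSpace ℝ κ) (v : Stack ι κ) : drDeriv A b x₀ α θ v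
      = (v - graphProj A v) + (graphSet A).reflection (proxDeriv A b x₀ α θ v) :=
  add_starProjection_two_smul_sub_sub _ _ _

lemma prox_smul (a : EuclideanSpace ℝ κ) {α : ℂ} (hα : ‖α‖ = 1) (w : Stack ι κ) :
    prox a (α • w) = α • prox a w := by
  refine stack_ext (by simp [prox]) fun i ↦ ?_
  simp [prox, phase_mul, phase_of_norm_eq_one hα, mul_left_comm]

lemma drMap_smul (A : Matrix ι κ ℂ) (a : EuclideanSpace ℝ κ) {α : ℂ} (hα : ‖α‖ = 1)
    (w : Stack ι κ) : drMap A a (α • w) = α • drMap A a w := by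
  simp only [drMap_eq, prox_smul a hα, graphProj, map_smul, smul_add, smul_sub]

lemma prox_add_sub_prox (a noise : EuclideanSpace ℝ κ) (w : Stack ι κ) :
    prox (a + noise) w - prox a w = shiftVec (fun i ↦ phase (w.snd i)) noise :=
  stack_ext (by simp [prox]) fun i ↦ by simp [prox, add_mul]

lemma norm_drMap_add_sub_le (A : Matrix ι κ ℂ) (a noise : EuclideanSpace ℝ κ) (w : Stack ι κ) :
    ‖drMap A (a + noise) w - drMap A a w‖ ≤ ‖noise‖ := by
  rw [drMap_eq, drMap_eq, add_sub_add_left_eq_sub, ← map_sub, LinearIsometryEquiv.norm_map,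
    prox_add_sub_prox]
  exact norm_shiftVec_le (fun i ↦ norm_phase_le _) noise

end DouglasRachford

/-! ### Fixed points and first-order expansion -/

section FixedPoints

variable {ι κ : Type*} [Fintype ι] {A : Matrix ι κ ℂ} {b : EuclideanSpace ℝ κ}
  {x₀ : EuclideanSpace ℂ ι}

lemma bMin_le [Finite κ] (b : EuclideanSpace ℝ κ) (i : κ) : bMin b ≤ b i :=
  ciInf_le (Set.finite_range _).bddBelow i

/-- The phases `y₀ / |y₀|` of the measurements `y₀ = A* x₀`. -/
noncomputable abbrev measPhase (A : Matrix ι κ ℂ) (x₀ : EuclideanSpace ℂ ι) (i : κ) : ℂ :=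
  phase (meas A x₀ i)

/-- `b` consists of the amplitudes of the measurements of `x₀`, all of which are positive. -/
structure IsAmplitude (A : Matrix ι κ ℂ) (b : EuclideanSpace ℝ κ) (x₀ : EuclideanSpace ℂ ι) :
    Prop where
  pos : ∀ i, 0 < b i
  norm_meas : ∀ i, ‖meas A x₀ i‖ = b i

lemma IsAmplitude.norm_measPhase (hA : IsAmplitude A b x₀) (i : κ) : ‖measPhase A x₀ i‖ = 1 :=
  norm_phase (norm_pos_iff.1 ((hA.norm_meas i).symm ▸ hA.pos i))

lemma IsAmplitude.mul_measPhase (hA : IsAmplitude A b x₀) (i : κ) :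
    (b i : ℂ) * measPhase A x₀ i = meas A x₀ i := by
  rw [← hA.norm_meas i, norm_mul_phase]

variable [Fintype κ]

/-- The space of shifts `θ ∈ ℝ^κ` with `A (θ ∘ y₀ / |y₀|) = 0`, encoded as orthogonality of
`(0, θ ∘ y₀ / |y₀|)` to the graph set: `shiftSet` without its sign condition. -/
noncomputable def balancedShifts (A : Matrix ι κ ℂ) (x₀ : EuclideanSpace ℂ ι) :
    Submodule ℝ (EuclideanSpace ℝ κ) :=
  ((graphSet A)ᗮ.restrictScalars ℝ).comap (shiftVec (measPhase A x₀))

lemma mem_balancedShifts {θ : EuclideanSpace ℝ κ} :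
    θ ∈ balancedShifts A x₀ ↔ shiftVec (measPhase A x₀) θ ∈ (graphSet A)ᗮ := Iff.rfl

lemma mem_shiftSet {θ : EuclideanSpace ℝ κ} :
    θ ∈ shiftSet A b x₀ ↔ θ ∈ balancedShifts A x₀ ∧ ∀ i, 0 ≤ b i + θ i :=
  and_congr_left' (stack_zero_mem_graphSet_orthogonal (A := A)
    (y := WithLp.toLp 2 fun i ↦ (θ i : ℂ) * measPhase A x₀ i)).symm

lemma IsAmplitude.snd_solPoint_add_shiftVec (hA : IsAmplitude A b x₀) (θ : EuclideanSpace ℝ κ)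
    (i : κ) : (solPoint A x₀ + shiftVec (measPhase A x₀) θ).snd i
      = ((b i + θ i : ℝ) : ℂ) * measPhase A x₀ i := by
  rw [Complex.ofReal_add, add_mul, hA.mul_measPhase]
  rfl

lemma IsAmplitude.fixedPoint_eq (hA : IsAmplitude A b x₀) (α : ℂ) (θ : EuclideanSpace ℝ κ) :
    fixedPoint A b x₀ α θ = α • (solPoint A x₀ + shiftVec (measPhase A x₀) θ) := by
  refine stack_ext (by simp [fixedPoint, solPoint]) fun i ↦ ?_
  rw [WithLp.smul_snd, PiLp.smul_apply, hA.snd_solPoint_add_shiftVec]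
  rfl

lemma IsAmplitude.norm_le_norm_fixedPoint_sub (hA : IsAmplitude A b x₀) {α : ℂ} (hα : ‖α‖ = 1)
    {θ : EuclideanSpace ℝ κ} (hθ : θ ∈ balancedShifts A x₀) :
    ‖θ‖ ≤ ‖fixedPoint A b x₀ α θ - solPoint A x₀‖ := by
  set s : Stack ι κ := shiftVec (measPhase A x₀) θ
  have hs : α • s ∈ (graphSet A)ᗮ := Submodule.smul_mem _ _ (mem_balancedShifts.1 hθ)
  have hsol : (α - 1) • solPoint A x₀ ∈ graphSet A :=
    Submodule.smul_mem _ _ (solPoint_mem_graphSet A x₀)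
  have hproj : (graphSet A)ᗮ.starProjection (fixedPoint A b x₀ α θ - solPoint A x₀) = α • s := by
    have hsplit : fixedPoint A b x₀ α θ - solPoint A x₀
        = α • s + (α - 1) • solPoint A x₀ := by
      rw [hA.fixedPoint_eq]
      module
    rw [hsplit, map_add, Submodule.starProjection_eq_self_iff.2 hs,
      Submodule.starProjection_orthogonal_apply_eq_zero hsol, add_zero]
  calc ‖θ‖ = ‖α • s‖ := by rw [norm_smul, hα, one_mul, norm_shiftVec hA.norm_measPhase]
    _ ≤ ‖fixedPoint A b x₀ α θ - solPoint A x₀‖ := by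
      rw [← hproj]
      exact Submodule.norm_starProjection_apply_le _ _

lemma IsAmplitude.prox_solPoint_add_shiftVec (hA : IsAmplitude A b x₀) {θ : EuclideanSpace ℝ κ}
    (hθ : ∀ i, 0 < b i + θ i) :
    prox b (solPoint A x₀ + shiftVec (measPhase A x₀) θ) = solPoint A x₀ := by
  refine stack_ext (by simp [prox]) fun i ↦ ?_
  rw [prox, snd_stack, PiLp.toLp_apply, hA.snd_solPoint_add_shiftVec, phase_ofReal_mul (hθ i),
    phase_of_norm_eq_one (hA.norm_measPhase i), hA.mul_measPhase]
  rfl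

lemma IsAmplitude.drMap_solPoint_add_shiftVec (hA : IsAmplitude A b x₀)
    {θ : EuclideanSpace ℝ κ} (hθ : θ ∈ balancedShifts A x₀) (hpos : ∀ i, 0 < b i + θ i) :
    drMap A b (solPoint A x₀ + shiftVec (measPhase A x₀) θ)
      = solPoint A x₀ + shiftVec (measPhase A x₀) θ := by
  have hsol := solPoint_mem_graphSet A x₀
  rw [drMap_eq, hA.prox_solPoint_add_shiftVec hpos, graphProj, map_add,
    Submodule.starProjection_eq_self_iff.2 hsol,
    (Submodule.starProjection_apply_eq_zero_iff _).2 (mem_balancedShifts.1 hθ),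
    Submodule.reflection_mem_subspace_eq_self hsol]
  abel

lemma IsAmplitude.norm_prox_sub_sub_le (hA : IsAmplitude A b x₀) {θ : EuclideanSpace ℝ κ}
    (hb : 0 < bMin b) (hθ : ∀ i, b i / 2 ≤ b i + θ i) (v : Stack ι κ) :
    ‖prox b (solPoint A x₀ + shiftVec (measPhase A x₀) θ + v) - solPoint A x₀
        - proxDeriv A b x₀ 1 θ v‖ ≤ 16 / bMin b * ‖v‖ ^ 2 := by
  set e := prox b (solPoint A x₀ + shiftVec (measPhase A x₀) θ + v) - solPoint A x₀
    - proxDeriv A b x₀ 1 θ v with he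
  have hsnd (i : κ) : ‖e.snd i‖ ≤ 16 / bMin b * ‖v‖ * ‖v.snd i‖ := by
    set u := measPhase A x₀ i
    set r := b i + θ i
    set q := v.snd i
    have hbi := hA.pos i
    have hr : 0 < r := (half_pos hbi).trans_le (hθ i)
    have hq : ‖q‖ ≤ ‖v‖ := (PiLp.norm_apply_le v.snd i).trans (WithLp.norm_snd_le _ v)
    have hei : e.snd i
        = b i * (phase (r * u + q) - u - (r⁻¹ : ℝ) * (u * (Complex.I * (conj u * q).im))) := by
      have : e.snd i = b i * phase ((solPoint A x₀ + shiftVec (measPhase A x₀) θ).snd i + q)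
          - meas A x₀ i
          - ((b i / r : ℝ) : ℂ) * (1 * u * (Complex.I * ((conj (1 * u) * q).im : ℝ))) := rfl
      rw [this, hA.snd_solPoint_add_shiftVec, ← hA.mul_measPhase, one_mul, div_eq_mul_inv,
        Complex.ofReal_mul]
      ring
    calc ‖e.snd i‖ ≤ b i * (4 * (‖q‖ / r) ^ 2) := by
          rw [hei, norm_mul, Complex.norm_real, Real.norm_of_nonneg hbi.le]
          gcongr
          exact norm_phase_add_sub_le hr (hA.norm_measPhase i) q
      _ ≤ b i * (4 * (‖q‖ / (b i / 2)) ^ 2) := by gcongr; exact hθ i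
      _ = 16 / b i * ‖q‖ * ‖q‖ := by field_simp; ring
      _ ≤ 16 / bMin b * ‖v‖ * ‖q‖ := by gcongr; exact bMin_le b i
  have hC : 0 ≤ 16 / bMin b * ‖v‖ := by positivity
  calc ‖e‖ ≤ ‖((16 / bMin b * ‖v‖ : ℝ) : ℂ) • v‖ := by
        refine norm_le_norm_of_norm_apply_le ?_ fun i ↦ ?_
        · have hfst : e.fst = 0 := by simp [he, prox, proxDeriv, solPoint]
          rw [hfst, norm_zero]
          exact norm_nonneg _
        · rw [WithLp.smul_snd, PiLp.smul_apply, norm_smul, Complex.norm_real,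
            Real.norm_of_nonneg hC]
          exact hsnd i
    _ = 16 / bMin b * ‖v‖ ^ 2 := by
        rw [norm_smul, Complex.norm_real, Real.norm_of_nonneg hC]
        ring

lemma IsAmplitude.norm_drMap_sub_sub_le (hA : IsAmplitude A b x₀) {θ : EuclideanSpace ℝ κ}
    (hb : 0 < bMin b) (hθ : θ ∈ balancedShifts A x₀) (hhalf : ∀ i, b i / 2 ≤ b i + θ i)
    (v : Stack ι κ) :
    ‖drMap A b (solPoint A x₀ + shiftVec (measPhase A x₀) θ + v)
        - (solPoint A x₀ + shiftVec (measPhase A x₀) θ) - drDeriv A b x₀ 1 θ v‖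
      ≤ 16 / bMin b * ‖v‖ ^ 2 := by
  have hpos (i : κ) : 0 < b i + θ i := (half_pos (hA.pos i)).trans_le (hhalf i)
  set z := solPoint A x₀ + shiftVec (measPhase A x₀) θ
  have hreflect : drMap A b (z + v) - z - drDeriv A b x₀ 1 θ v
      = (graphSet A).reflection
          (prox b (z + v) - solPoint A x₀ - proxDeriv A b x₀ 1 θ v) := by
    have hz : drMap A b z = z := hA.drMap_solPoint_add_shiftVec hθ hpos
    have hprox : prox b z = solPoint A x₀ := hA.prox_solPoint_add_shiftVec hpos
    nth_rw 2 [← hz]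
    simp only [drMap_eq, drDeriv_eq, graphProj, map_add, map_sub, hprox]
    abel
  rw [hreflect, LinearIsometryEquiv.norm_map]
  exact hA.norm_prox_sub_sub_le hb hhalf v

end FixedPoints

/-! ### Normal vectors and contraction -/

section Contraction

variable {ι κ : Type*} [Fintype ι] {A : Matrix ι κ ℂ} {b : EuclideanSpace ℝ κ}
  {x₀ : EuclideanSpace ℂ ι}

/-- Magnitude retrieval: the phases of its measurements determine a signal up to a real factor. -/
def MagnitudeRetrieval (A : Matrix ι κ ℂ) (x₀ : EuclideanSpace ℂ ι) : Prop :=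
  ∀ x, (∀ i, phase (meas A x i) = phase (meas A x₀ i)) → ∃ c : ℝ, x = (c : ℂ) • x₀

variable [Fintype κ]

/-- `v` is orthogonal, for the real inner product `Re ⟪·, ·⟫`, to the directions tangent to
`fixedSet` at `solPoint A x₀ + shiftVec (measPhase A x₀) θ`: to all shifts, and to the phase
direction, which is `I` times the base point. -/
structure IsNormal (A : Matrix ι κ ℂ) (x₀ : EuclideanSpace ℂ ι) (θ : EuclideanSpace ℝ κ)
    (v : Stack ι κ) : Prop where
  shift : ∀ η ∈ balancedShifts A x₀, (inner ℂ (shiftVec (measPhase A x₀) η) v).re = 0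
  phase : (inner ℂ (solPoint A x₀ + shiftVec (measPhase A x₀) θ) v).im = 0

lemma IsNormal.smul {θ : EuclideanSpace ℝ κ} {v : Stack ι κ} (t : ℝ) (h : IsNormal A x₀ θ v) :
    IsNormal A x₀ θ (t • v) := by
  rw [← Complex.coe_smul]
  refine ⟨fun η hη ↦ ?_, ?_⟩
  · rw [inner_smul_right, Complex.re_ofReal_mul, h.shift η hη, mul_zero]
  · rw [inner_smul_right, Complex.im_ofReal_mul, h.phase, mul_zero]

lemma isClosed_isNormal (A : Matrix ι κ ℂ) (x₀ : EuclideanSpace ℂ ι) :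
    IsClosed {p : EuclideanSpace ℝ κ × Stack ι κ | IsNormal A x₀ p.1 p.2} := by
  have hshift : Continuous (shiftVec (measPhase A x₀) : EuclideanSpace ℝ κ → Stack ι κ) :=
    LinearMap.continuous_of_finiteDimensional _
  have hset : {p : EuclideanSpace ℝ κ × Stack ι κ | IsNormal A x₀ p.1 p.2}
      = (⋂ η ∈ balancedShifts A x₀, {p | (inner ℂ (shiftVec (measPhase A x₀) η) p.2).re = 0}) ∩
        {p | (inner ℂ (solPoint A x₀ + shiftVec (measPhase A x₀) p.1) p.2).im = 0} := by
    ext p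
    simp only [Set.mem_inter_iff, Set.mem_iInter, Set.mem_ofPred_eq]
    exact ⟨fun h ↦ ⟨h.shift, h.phase⟩, fun h ↦ ⟨h.1, h.2⟩⟩
  rw [hset]
  refine .inter (isClosed_biInter fun η _ ↦ isClosed_eq ?_ continuous_const)
    (isClosed_eq ?_ continuous_const)
  · fun_prop
  · fun_prop

lemma norm_smul_sub_of_norm_eq_one {E : Type*} [NormedAddCommGroup E] [NormedSpace ℂ E] {α : ℂ}
    (hα : ‖α‖ = 1) (x y : E) : ‖α • x - y‖ = ‖x - conj α • y‖ := by
  have hfactor : α • x - y = α • (x - conj α • y) := by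
    rw [smul_sub, smul_smul, mul_conj_of_norm_eq_one hα, one_smul]
  rw [hfactor, norm_smul, hα, one_mul]

lemma IsProjection.norm_sub_le {w z : Stack ι κ} {α : ℂ} {θ : EuclideanSpace ℝ κ}
    (h : IsProjection A b x₀ w α θ) (hz : z ∈ fixedSet A b x₀) :
    ‖w - fixedPoint A b x₀ α θ‖ ≤ ‖w - z‖ := by
  rw [norm_sub_rev, norm_sub_rev w]
  exact h.2.2 z hz

lemma IsProjection.isNormal {w : Stack ι κ} {α : ℂ} {θ : EuclideanSpace ℝ κ}
    (h : IsProjection A b x₀ w α θ) (hA : IsAmplitude A b x₀) (hpos : ∀ i, 0 < b i + θ i) :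
    IsNormal A x₀ θ (conj α • w - (solPoint A x₀ + shiftVec (measPhase A x₀) θ)) := by
  obtain ⟨hα, hθ, hmin⟩ := h
  have hmin' {c : ℂ} (hc : ‖c‖ = 1) {η : EuclideanSpace ℝ κ} (hη : η ∈ shiftSet A b x₀) :
      ‖solPoint A x₀ + shiftVec (measPhase A x₀) θ - conj α • w‖
        ≤ ‖c • (solPoint A x₀ + shiftVec (measPhase A x₀) η) - conj α • w‖ := by
    have := hmin _ ⟨α * c, by rw [norm_mul, hα, hc, one_mul], η, hη, rfl⟩
    rwa [hA.fixedPoint_eq, hA.fixedPoint_eq, mul_smul, norm_smul_sub_of_norm_eq_one hα,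
      norm_smul_sub_of_norm_eq_one hα] at this
  refine ⟨fun η hη ↦ re_inner_eq_zero_of_eventually_norm_sub_le ?_,
    im_inner_eq_zero_of_norm_sub_le_smul fun c hc ↦ hmin' hc hθ⟩
  have hfeasible : ∀ᶠ t : ℝ in nhds 0, ∀ i, 0 < b i + (θ i + t * η i) := by
    refine Filter.eventually_all.2 fun i ↦ ?_
    have hcont : Continuous fun t : ℝ ↦ b i + (θ i + t * η i) := by fun_prop
    exact hcont.continuousAt.eventually (lt_mem_nhds (by simpa using hpos i))
  filter_upwards [hfeasible] with t ht
  have hmem : θ + t • η ∈ shiftSet A b x₀ :=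
    mem_shiftSet.2 ⟨add_mem (mem_shiftSet.1 hθ).1 (Submodule.smul_mem _ t hη), fun i ↦ (ht i).le⟩
  simpa only [one_smul, map_add, map_smul, ← add_assoc, Complex.coe_smul]
    using hmin' norm_one hmem

lemma IsAmplitude.snd_proxDeriv_one_zero (hA : IsAmplitude A b x₀) (v : Stack ι κ) (i : κ) :
    (proxDeriv A b x₀ 1 0 v).snd i
      = measPhase A x₀ i * (Complex.I * (conj (measPhase A x₀ i) * v.snd i).im) := by
  simp [proxDeriv, (hA.pos i).ne']

lemma IsAmplitude.norm_two_smul_proxDeriv_sub (hA : IsAmplitude A b x₀) (v : Stack ι κ) :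
    ‖(2 : ℂ) • proxDeriv A b x₀ 1 0 v - v‖ = ‖v‖ := by
  have hfst : ((2 : ℂ) • proxDeriv A b x₀ 1 0 v - v).fst = v.fst := by
    simp [proxDeriv, two_smul]
  have hsnd (i : κ) : ‖((2 : ℂ) • proxDeriv A b x₀ 1 0 v - v).snd i‖ = ‖v.snd i‖ := by
    have hreflect : ((2 : ℂ) • proxDeriv A b x₀ 1 0 v - v).snd i
        = -(measPhase A x₀ i * conj (conj (measPhase A x₀ i) * v.snd i)) := by
      have hv := eq_mul_I_im_add_mul_re (hA.norm_measPhase i) (v.snd i)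
      have hconj := Complex.re_add_im (conj (conj (measPhase A x₀ i) * v.snd i))
      rw [Complex.conj_re, Complex.conj_im, Complex.ofReal_neg] at hconj
      rw [WithLp.sub_snd, WithLp.smul_snd, PiLp.sub_apply, PiLp.smul_apply, smul_eq_mul,
        hA.snd_proxDeriv_one_zero]
      linear_combination -hv - measPhase A x₀ i * hconj
    rw [hreflect, norm_neg, norm_mul, RCLike.norm_conj, norm_mul, RCLike.norm_conj,
      hA.norm_measPhase, one_mul, one_mul]
  exact le_antisymm (norm_le_norm_of_norm_apply_le (by rw [hfst]) fun i ↦ (hsnd i).le)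
    (norm_le_norm_of_norm_apply_le (by rw [hfst]) fun i ↦ (hsnd i).ge)

lemma IsAmplitude.exists_sub_proxDeriv_eq_shiftVec (hA : IsAmplitude A b x₀) (v : Stack ι κ) :
    ∃ η, v - proxDeriv A b x₀ 1 0 v = shiftVec (measPhase A x₀) η := by
  refine ⟨WithLp.toLp 2 fun i ↦ (conj (measPhase A x₀ i) * v.snd i).re,
    stack_ext (by simp [proxDeriv]) fun i ↦ ?_⟩
  have hv := eq_mul_I_im_add_mul_re (hA.norm_measPhase i) (v.snd i)
  rw [WithLp.sub_snd, PiLp.sub_apply, hA.snd_proxDeriv_one_zero, snd_shiftVec, PiLp.toLp_apply]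
  linear_combination hv

/-- Adding a large multiple of the solution makes all entries of `τ` positive, so that the phases
of the measurements become those of the solution. -/
lemma MagnitudeRetrieval.exists_eq_smul_solPoint (hM : MagnitudeRetrieval A x₀)
    (hA : IsAmplitude A b x₀) {w : Stack ι κ} (hw : w ∈ graphSet A) {τ : κ → ℝ}
    (hτ : ∀ i, w.snd i = τ i * measPhase A x₀ i) : ∃ c : ℝ, w = (c : ℂ) • solPoint A x₀ := by
  obtain ⟨M, hτM⟩ : ∃ M : ℝ, ∀ i, -τ i / b i < M :=
    (Filter.eventually_all.2 fun i ↦ Filter.eventually_gt_atTop (-τ i / b i)).exists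
  set w' := w + (M : ℂ) • solPoint A x₀ with hw'
  have hmem : w' ∈ graphSet A :=
    add_mem hw (Submodule.smul_mem _ _ (solPoint_mem_graphSet A x₀))
  have hsnd (i : κ) : w'.snd i = ((τ i + M * b i : ℝ) : ℂ) * measPhase A x₀ i := by
    rw [hw', WithLp.add_snd, WithLp.smul_snd, PiLp.add_apply, PiLp.smul_apply, hτ, smul_eq_mul,
      solPoint, snd_stack, ← hA.mul_measPhase]
    push_cast
    ring
  have hphase (i : κ) : phase (meas A w'.fst i) = phase (meas A x₀ i) := by
    have hpos : 0 < τ i + M * b i := by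
      linarith [(div_lt_iff₀ (hA.pos i)).1 (hτM i)]
    rw [mem_graphSet.1 hmem, hsnd, phase_ofReal_mul hpos,
      phase_of_norm_eq_one (hA.norm_measPhase i)]
  obtain ⟨c, hc⟩ := hM w'.fst hphase
  have hwc : w' = (c : ℂ) • solPoint A x₀ :=
    eq_of_mem_graphSet hmem (Submodule.smul_mem _ _ (solPoint_mem_graphSet A x₀)) hc
  refine ⟨c - M, ?_⟩
  rw [Complex.ofReal_sub, sub_smul, ← hwc, hw', add_sub_cancel_right]

lemma MagnitudeRetrieval.exists_eq_mul_I_smul_solPoint (hM : MagnitudeRetrieval A x₀)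
    (hA : IsAmplitude A b x₀) {v : Stack ι κ} (hv : v ∈ graphSet A)
    (hfix : proxDeriv A b x₀ 1 0 v = v) : ∃ c : ℝ, v = (c * Complex.I : ℂ) • solPoint A x₀ := by
  obtain ⟨c, hc⟩ := hM.exists_eq_smul_solPoint hA (Submodule.smul_mem _ (-Complex.I) hv)
    (τ := fun i ↦ (conj (measPhase A x₀ i) * v.snd i).im) fun i ↦ by
      conv_lhs => rw [← hfix]
      rw [WithLp.smul_snd, PiLp.smul_apply, smul_eq_mul, hA.snd_proxDeriv_one_zero]
      linear_combination (-measPhase A x₀ i * (conj (measPhase A x₀ i) * v.snd i).im)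
        * Complex.I_mul_I
  refine ⟨c, ?_⟩
  rw [mul_comm, mul_smul, ← hc, smul_smul, mul_neg, Complex.I_mul_I, neg_neg, one_smul]

lemma eq_zero_of_norm_le_norm_drDeriv (hA : IsAmplitude A b x₀) (hM : MagnitudeRetrieval A x₀)
    {θ : EuclideanSpace ℝ κ} (hθ : θ ∈ balancedShifts A x₀) {v : Stack ι κ}
    (hv : IsNormal A x₀ θ v) (hle : ‖v‖ ≤ ‖drDeriv A b x₀ 1 0 v‖) : v = 0 := by
  have hproj : (graphSet A).starProjection v = proxDeriv A b x₀ 1 0 v :=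
    starProjection_eq_of_norm_le _ (hA.norm_two_smul_proxDeriv_sub v) hle
  obtain ⟨η, hη⟩ := hA.exists_sub_proxDeriv_eq_shiftVec v
  have hη_mem : η ∈ balancedShifts A x₀ := by
    rw [mem_balancedShifts, ← hη, ← hproj]
    exact Submodule.sub_starProjection_mem_orthogonal v
  have hgraph : proxDeriv A b x₀ 1 0 v ∈ graphSet A :=
    hproj ▸ Submodule.starProjection_apply_mem _ v
  have hfix : proxDeriv A b x₀ 1 0 v = v := by
    have horth : inner ℂ (shiftVec (measPhase A x₀) η) (proxDeriv A b x₀ 1 0 v) = 0 :=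
      Submodule.inner_left_of_mem_orthogonal hgraph (mem_balancedShifts.1 hη_mem)
    have hself := hv.shift η hη_mem
    rw [← sub_add_cancel v (proxDeriv A b x₀ 1 0 v), inner_add_right, horth, add_zero, hη,
      inner_self_eq_norm_sq_to_K] at hself
    have hzero : (shiftVec (measPhase A x₀) η : Stack ι κ) = 0 := by
      simpa [← Complex.ofReal_pow] using hself
    exact (sub_eq_zero.1 (hη.trans hzero)).symm
  obtain ⟨c, hc⟩ := hM.exists_eq_mul_I_smul_solPoint hA (hfix ▸ hgraph) hfix
  have horth : inner ℂ (shiftVec (measPhase A x₀) θ) (solPoint A x₀) = 0 :=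
    Submodule.inner_left_of_mem_orthogonal (solPoint_mem_graphSet A x₀) (mem_balancedShifts.1 hθ)
  have hphase : c * ‖solPoint A x₀‖ ^ 2 = 0 := by
    have := hv.phase
    rw [hc, inner_smul_right, inner_add_left, horth, add_zero, inner_self_eq_norm_sq_to_K,
      mul_assoc, Complex.im_ofReal_mul] at this
    simpa [← Complex.ofReal_pow] using this
  rcases mul_eq_zero.1 hphase with h | h
  · rw [hc, h, Complex.ofReal_zero, zero_mul, zero_smul]
  · rw [hc, norm_eq_zero.1 (pow_eq_zero_iff two_ne_zero |>.1 h), smul_zero]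

lemma continuous_drDeriv (A : Matrix ι κ ℂ) (b : EuclideanSpace ℝ κ) (x₀ : EuclideanSpace ℂ ι)
    (α : ℂ) (θ : EuclideanSpace ℝ κ) : Continuous (drDeriv A b x₀ α θ) := by
  unfold drDeriv graphProj proxDeriv stack
  fun_prop

lemma drDeriv_smul (A : Matrix ι κ ℂ) (b : EuclideanSpace ℝ κ) (x₀ : EuclideanSpace ℂ ι) (α : ℂ)
    (θ : EuclideanSpace ℝ κ) (t : ℝ) (v : Stack ι κ) :
    drDeriv A b x₀ α θ (t • v) = t • drDeriv A b x₀ α θ v := by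
  have hprox : proxDeriv A b x₀ α θ ((t : ℂ) • v) = (t : ℂ) • proxDeriv A b x₀ α θ v := by
    refine stack_ext (by simp [proxDeriv]) fun i ↦ ?_
    simp only [proxDeriv, snd_stack, WithLp.smul_snd, PiLp.smul_apply, smul_eq_mul]
    rw [mul_left_comm _ (t : ℂ), Complex.im_ofReal_mul]
    push_cast
    ring
  rw [← Complex.coe_smul, ← Complex.coe_smul]
  simp only [drDeriv_eq, hprox, graphProj, map_smul, smul_add, smul_sub]

/-- The linearization at the solution contracts, with factor `β`, the normal vectors at all shifted
solutions whose shift has norm at most `r`. -/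
def ContractsNormals (A : Matrix ι κ ℂ) (b : EuclideanSpace ℝ κ) (x₀ : EuclideanSpace ℂ ι)
    (r β : ℝ) : Prop :=
  ∀ θ ∈ balancedShifts A x₀, ‖θ‖ ≤ r → ∀ v, IsNormal A x₀ θ v →
    ‖drDeriv A b x₀ 1 0 v‖ ≤ β * ‖v‖

lemma exists_contractsNormals (hA : IsAmplitude A b x₀) (hM : MagnitudeRetrieval A x₀) (r : ℝ) :
    ∃ β : ℝ, 0 ≤ β ∧ β < 1 ∧ ContractsNormals A b x₀ r β := by
  have : ProperSpace (Stack ι κ) := FiniteDimensional.proper ℂ _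
  have hcompact :
      IsCompact (Metric.closedBall 0 r ∩ (balancedShifts A x₀ : Set (EuclideanSpace ℝ κ))) :=
    (isCompact_closedBall _ _).inter_right (balancedShifts A x₀).closed_of_finiteDimensional
  obtain ⟨β, hβ₀, hβ₁, hβ⟩ := exists_norm_le_mul_norm_of_isCompact hcompact
    (isClosed_isNormal A x₀) IsNormal.smul (continuous_drDeriv A b x₀ 1 0)
    (drDeriv_smul A b x₀ 1 0) fun θ hθ v ↦ eq_zero_of_norm_le_norm_drDeriv hA hM hθ.2
  exact ⟨β, hβ₀, hβ₁, fun θ hθ hr ↦ hβ θ ⟨mem_closedBall_zero_iff.2 hr, hθ⟩⟩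

end Contraction

/-! ### One step of the noisy iteration -/

section NoisyStep

variable {ι κ : Type*} [Fintype ι] [Fintype κ] {A : Matrix ι κ ℂ} {b : EuclideanSpace ℝ κ}
  {x₀ : EuclideanSpace ℂ ι} {β ε₁ ε₂ : ℝ} {θ : EuclideanSpace ℝ κ}

lemma half_le_add_of_norm_le (hθ : ‖θ‖ ≤ bMin b / 2) (i : κ) : b i / 2 ≤ b i + θ i := by
  have hθi : -(bMin b / 2) ≤ θ i := (abs_le.1 ((PiLp.norm_apply_le θ i).trans hθ)).1
  linarith [bMin_le b i]

lemma ContractsNormals.norm_drMap_sub_le (hβ : ContractsNormals A b x₀ (bMin b / 2) β)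
    (hA : IsAmplitude A b x₀) (hb : 0 < bMin b) (hε₂ : ε₂ ≤ bMin b / 2)
    (hclose : LinearizationClose A b x₀ ε₁ ε₂) (hθ : θ ∈ shiftSet A b x₀) (hθε : ‖θ‖ ≤ ε₂)
    {v : Stack ι κ} (hv : IsNormal A x₀ θ v) :
    ‖drMap A b (solPoint A x₀ + shiftVec (measPhase A x₀) θ + v)
        - (solPoint A x₀ + shiftVec (measPhase A x₀) θ)‖
      ≤ (β + ε₁ + 16 / bMin b * ‖v‖) * ‖v‖ := by
  set z := solPoint A x₀ + shiftVec (measPhase A x₀) θ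
  have hθ' := (mem_shiftSet.1 hθ).1
  calc ‖drMap A b (z + v) - z‖
      = ‖(drMap A b (z + v) - z - drDeriv A b x₀ 1 θ v)
          + (drDeriv A b x₀ 1 θ v - drDeriv A b x₀ 1 0 v) + drDeriv A b x₀ 1 0 v‖ := by
        congr 1
        abel
    _ ≤ 16 / bMin b * ‖v‖ ^ 2 + ε₁ * ‖v‖ + β * ‖v‖ :=
        norm_add_le_of_le (norm_add_le_of_le
          (hA.norm_drMap_sub_sub_le hb hθ' (half_le_add_of_norm_le (hθε.trans hε₂)) v)
          (hclose 1 norm_one θ hθ hθε v)) (hβ θ hθ' (hθε.trans hε₂) v hv)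
    _ = (β + ε₁ + 16 / bMin b * ‖v‖) * ‖v‖ := by ring

lemma ContractsNormals.norm_drMap_add_sub_fixedPoint_le
    (hβ : ContractsNormals A b x₀ (bMin b / 2) β) (hA : IsAmplitude A b x₀) (hb : 0 < bMin b)
    (hε₂ : ε₂ ≤ bMin b / 2) (hclose : LinearizationClose A b x₀ ε₁ ε₂) {w : Stack ι κ} {α : ℂ}
    (hp : IsProjection A b x₀ w α θ) (hnear : ‖fixedPoint A b x₀ α θ - solPoint A x₀‖ ≤ ε₂)
    (noise : EuclideanSpace ℝ κ) :
    ‖drMap A (b + noise) w - fixedPoint A b x₀ α θ‖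
      ≤ (β + ε₁ + 16 / bMin b * ‖w - fixedPoint A b x₀ α θ‖) * ‖w - fixedPoint A b x₀ α θ‖
        + ‖noise‖ := by
  obtain ⟨hα, hθ, -⟩ := id hp
  have hθε : ‖θ‖ ≤ ε₂ := (hA.norm_le_norm_fixedPoint_sub hα (mem_shiftSet.1 hθ).1).trans hnear
  have hpos (i : κ) : 0 < b i + θ i :=
    (half_pos (hA.pos i)).trans_le (half_le_add_of_norm_le (hθε.trans hε₂) i)
  set z := solPoint A x₀ + shiftVec (measPhase A x₀) θ
  set v := conj α • w - z with hv
  have hw : w = α • (z + v) := by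
    rw [hv, add_sub_cancel, smul_smul, mul_conj_of_norm_eq_one hα, one_smul]
  have hfixed : fixedPoint A b x₀ α θ = α • z := hA.fixedPoint_eq α θ
  have norm_v : ‖w - fixedPoint A b x₀ α θ‖ = ‖v‖ := by
    rw [hw, hfixed, ← smul_sub, add_sub_cancel_left, norm_smul, hα, one_mul]
  have hnoiseless : ‖drMap A b w - fixedPoint A b x₀ α θ‖
      ≤ (β + ε₁ + 16 / bMin b * ‖v‖) * ‖v‖ := by
    rw [hw, hfixed, drMap_smul A b hα, ← smul_sub, norm_smul, hα, one_mul]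
    exact hβ.norm_drMap_sub_le hA hb hε₂ hclose hθ hθε (hp.isNormal hA hpos)
  rw [norm_v, add_comm (_ * _)]
  exact (norm_sub_le_norm_sub_add_norm_sub _ (drMap A b w) _).trans
    (add_le_add (norm_drMap_add_sub_le A b noise w) hnoiseless)

lemma phaseDist_le (x x₀ : EuclideanSpace ℂ ι) {α : ℂ} (hα : ‖α‖ = 1) :
    phaseDist x x₀ ≤ ‖x - α • x₀‖ :=
  ciInf_le (f := fun a : Circle ↦ ‖x - (a : ℂ) • x₀‖)
    ⟨0, Set.forall_mem_range.2 fun _ ↦ norm_nonneg _⟩ ⟨α, mem_sphere_zero_iff_norm.2 hα⟩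

lemma phaseDist_fst_le (w : Stack ι κ) {α : ℂ} (hα : ‖α‖ = 1) :
    phaseDist w.fst x₀ ≤ ‖w - fixedPoint A b x₀ α θ‖ :=
  (phaseDist_le w.fst x₀ hα).trans (WithLp.norm_fst_le _ (w - fixedPoint A b x₀ α θ))

end NoisyStep

end GPS

theorem theorem3p2_general {ι κ : Type*} [Fintype ι] [Fintype κ]
    (A : Matrix ι κ ℂ) (b : EuclideanSpace ℝ κ) (x₀ : EuclideanSpace ℂ ι)
    (hA : GPS.IsAmplitude A b x₀) (hM : GPS.MagnitudeRetrieval A x₀) :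
    ∃ β : ℝ, 0 < β ∧ β < 1 ∧
      ∀ ε₁ : ℝ, 0 < ε₁ → β + ε₁ < 1 →
      ∀ ε₂ : ℝ, 0 < ε₂ → ε₂ ≤ GPS.bMin b / 2 → GPS.LinearizationClose A b x₀ ε₁ ε₂ →
      ∃ ε₃ : ℝ, 0 < ε₃ ∧
        ∀ (noise : EuclideanSpace ℝ κ) (s₀ : GPS.State ι κ)
          (α : ℕ → ℂ) (θ : ℕ → EuclideanSpace ℝ κ),
          (∀ k, 1 ≤ k →
            GPS.IsProjection A b x₀ (GPS.iter A (b + noise) s₀ k).dr (α k) (θ k)) →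
          ‖(GPS.iter A (b + noise) s₀ 1).dr - GPS.fixedPoint A b x₀ (α 1) (θ 1)‖ ≤ ε₃ →
          ‖noise‖ ≤ ‖(GPS.iter A (b + noise) s₀ 1).dr - GPS.fixedPoint A b x₀ (α 1) (θ 1)‖ →
          ∀ k, 1 ≤ k →
            (∀ j, 1 ≤ j → j < k →
              ‖GPS.fixedPoint A b x₀ (α j) (θ j) - GPS.solPoint A x₀‖ ≤ ε₂) →
            GPS.phaseDist (GPS.iter A (b + noise) s₀ k).z.fst x₀ ≤
              (β + ε₁) ^ (k - 1) *
                  ‖(GPS.iter A (b + noise) s₀ 1).dr - GPS.fixedPoint A b x₀ (α 1) (θ 1)‖ +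
                1 / (1 - (β + ε₁)) * ‖noise‖ := by
  obtain ⟨q, hq₀, hq₁, hq⟩ := GPS.exists_contractsNormals hA hM (GPS.bMin b / 2)
  refine ⟨(1 + q) / 2, by linarith, by linarith, fun ε₁ hε₁ hρ ε₂ hε₂ hε₂' hclose ↦ ?_⟩
  have hb : 0 < GPS.bMin b := by linarith
  set ρ := (1 + q) / 2 + ε₁ with hρ_def
  set C := 16 / GPS.bMin b
  have hD : 0 < C * (1 + 1 / (1 - ρ)) := by
    have := sub_pos.2 hρ
    positivity
  refine ⟨(1 - q) / 2 / (C * (1 + 1 / (1 - ρ))), div_pos (by linarith) hD, ?_⟩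
  intro noise s₀ α θ hproj hd hnoise k hk hnear
  obtain ⟨N, rfl⟩ := Nat.exists_eq_add_of_le' hk
  let d (n : ℕ) : ℝ :=
    ‖(GPS.iter A (b + noise) s₀ (n + 1)).dr - GPS.fixedPoint A b x₀ (α (n + 1)) (θ (n + 1))‖
  have hsmall : C * ((1 + 1 / (1 - ρ)) * d 0) ≤ ρ - (q + ε₁) := by
    have := (le_div_iff₀' hD).1 hd
    linarith
  have hstep (n : ℕ) (hn : n < N) : d (n + 1) ≤ (q + ε₁ + C * d n) * d n + ‖noise‖ := by
    have hp := hproj (n + 1) (by omega)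
    refine ((hproj (n + 2) (by omega)).norm_sub_le ⟨_, hp.1, _, hp.2.1, rfl⟩).trans ?_
    rw [GPS.iter_succ_succ_dr]
    exact hq.norm_drMap_add_sub_fixedPoint_le hA hb hε₂' hclose hp
      (hnear (n + 1) (by omega) (by omega)) noise
  rw [Nat.add_sub_cancel]
  calc GPS.phaseDist (GPS.iter A (b + noise) s₀ (N + 1)).z.fst x₀ ≤ d N := by
        rw [GPS.iter_succ_z, GPS.prox, GPS.fst_stack]
        exact GPS.phaseDist_fst_le _ (hproj (N + 1) hk).1
    _ ≤ ρ ^ N * d 0 + 1 / (1 - ρ) * ‖noise‖ :=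
        GPS.le_pow_mul_add_of_le_add_mul_self_mul_add (d := d) (fun _ ↦ norm_nonneg _)
          (by positivity) (by linarith) hρ (norm_nonneg noise) hnoise hsmall hstep N le_rfl

theorem theorem3p2 {ι κ : Type*} [Fintype ι] [Fintype κ] [AddCommGroup ι]
    (A : Matrix ι κ ℂ) (b : EuclideanSpace ℝ κ) (x₀ : EuclideanSpace ℂ ι)
    (hA : GPS.Assumptions A b x₀) :
    ∃ β : ℝ, 0 < β ∧ β < 1 ∧
      ∀ ε₁ : ℝ, 0 < ε₁ → β + ε₁ < 1 →
      ∀ ε₂ : ℝ, 0 < ε₂ → ε₂ < GPS.bMin b / 3 → GPS.LinearizationClose A b x₀ ε₁ ε₂ →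
      ∃ ε₃ : ℝ, 0 < ε₃ ∧
        ∀ (noise : EuclideanSpace ℝ κ) (s₀ : GPS.State ι κ)
          (α : ℕ → ℂ) (θ : ℕ → EuclideanSpace ℝ κ),
          (∀ k, 1 ≤ k →
            GPS.IsProjection A b x₀ (GPS.iter A (b + noise) s₀ k).dr (α k) (θ k)) →
          ‖(GPS.iter A (b + noise) s₀ 1).dr - GPS.fixedPoint A b x₀ (α 1) (θ 1)‖ ≤ ε₃ →
          ‖noise‖ < ‖(GPS.iter A (b + noise) s₀ 1).dr - GPS.fixedPoint A b x₀ (α 1) (θ 1)‖ →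
          ∀ k, 1 ≤ k →
            (∀ j, 1 ≤ j → j < k →
              (GPS.iter A (b + noise) s₀ j).dr ∈ GPS.nbhd A b x₀ (α j) ∧
              ‖GPS.fixedPoint A b x₀ (α j) (θ j) - GPS.solPoint A x₀‖ ≤ ε₂) →
            GPS.phaseDist (GPS.iter A (b + noise) s₀ k).z.fst x₀ ≤
              (β + ε₁) ^ (k - 1) *
                  ‖(GPS.iter A (b + noise) s₀ 1).dr - GPS.fixedPoint A b x₀ (α 1) (θ 1)‖ +
                1 / (1 - (β + ε₁)) * ‖noise‖ := by
  obtain ⟨β, hβ₀, hβ₁, h⟩ := theorem3p2_general A b x₀ ⟨hA.b_pos, hA.sol⟩ fun x hx ↦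
    (hA.magnitude_retrieval x fun i ↦ .inl (hx i)).imp fun _ hc ↦ hc.2
  exact ⟨β, hβ₀, hβ₁, fun ε₁ hε₁ hρ ε₂ hε₂ hε₂' hclose ↦
    (h ε₁ hε₁ hρ ε₂ hε₂ (by linarith) hclose).imp fun _ h ↦
      ⟨h.1, fun noise s₀ α θ hproj hd hnoise k hk hnear ↦
        h.2 noise s₀ α θ hproj hd hnoise.le k hk fun j hj hjk ↦ (hnear j hj hjk).2⟩⟩
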